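/- **Conventions.** $D(X)$ is the set of finitely supported probability distributions on a set $X$; random functions $X\to D(Y)$ are the morphisms of the symmetric monoidal category $\mathrm{Kl}(D)$, whose tensor is $\times$ on sets and whose unit $I$ is a one-point set. A *lens* $(X,S)\to(Y,R)$ is a class $[v,u]$ in $\int^{A}\mathrm{Kl}(D)(X,A\times Y)\times\mathrm{Kl}(D)(A\times R,S)$. A *Bayesian open game* $G:(X,S)\to(Y,R)$ consists of a set $\Sigma_G$, a function $\mathrm{play}_G$ from $\Sigma_G$ to lenses $(X,S)\to(Y,R)$, and, for every context, i.e. lens $c=[p,k]:(I,R)\to(X,Y)$ with $p\in D(\Theta\times X)$ and $k:\Theta\times Y\to D(R)$, a relation $\sigma\mapsto \mathrm{br}_G(c)(\sigma)\subseteq\Sigma_G$. Such games are composed sequentially and in parallel ($\otimes$): strategy sets are multiplied, play lenses are composed resp. tensored, and the best response of a composite is the product of the best responses of the components in their local contexts, in which the other component is played with its given strategy. For $x$ in the support of the $X$-marginal of $p\in D(\Theta\times X)$ write $\mathcal U(p)(x)\in D(\Theta)$ for the posterior $\theta\mapsto p(\theta,x)/\sum_{\theta'}p(\theta',x)$. For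 $q\in D(\Theta)$ and $\alpha\in D(Y)$ let $\mathbb E[k(q,\alpha)]$ be the expected value of $k:\Theta\times Y\to D(\mathbb R)$ under the product of $q$ and $\alpha$. The *Bayesian agent* $\mathcal A_{(X,Y)}:(X,I)\to(Y,\mathbb R)$ has strategies $\sigma:X\to D(Y)$, play lens $[\sigma,!]$, and $\mathrm{br}([p,k])(\sigma')$ is, for every $\sigma'$, the set of those $\sigma$ such that for all $x$ in the support of the $X$-marginal of $p$, $\sigma(x)\in\arg\max_{\alpha\in D(Y)}\mathbb E[k(\mathcal U(p)(x),\alpha)]$. The *type-copying agent* $\mathcal A^{\Delta}_{(X,Y)}:(X,I)\to(X\times Y,\mathbb R)$ is the composite of the copying computation on $X$ with $\mathrm{id}_{(X,I)}\otimes\mathcal A_{(X,Y)}$. **Lemma.** (a) For all sets $X,Y$, the game $\mathcal A^{\Delta}_{(X,Y)}$ is given, up to a bijection of strategy sets, by: $\Sigma=(X\to D(Y))$; $\mathrm{play}(\sigma)=[v,!]$, where $v(x)$ is the law of $(x,y)$ with $y\sim\sigma(x)$; and $\mathrm{br}([p,k])(\sigma)=\mathrm{br}_{\mathcal A_{(X,Y)}}([p',k'])(\sigma)$,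 where $p'\in D((\Theta\times X)\times X)$ is the law of $((\theta,x),x)$ for $(\theta,x)\sim p$, and $k'((\theta,x),y)=k(\theta,(x,y))$. (b) Let $n\in\mathbb N$ and let $X_1,\dots,X_n,Y_1,\dots,Y_n$ be sets. The $n$-fold tensor $\mathcal A^{\Delta^n}=\bigotimes_{i=1}^n\mathcal A^\Delta_{(X_i,Y_i)}$ is given, up to a bijection of strategy sets (and the structural isomorphisms identifying iterated with $n$-fold products), as follows. 1. $\Sigma_{\mathcal A^{\Delta^n}}=\prod_{i=1}^n(X_i\to D(Y_i))$. 2. $\mathrm{play}_{\mathcal A^{\Delta^n}}(\sigma_1,\dots,\sigma_n)=[v,!]$, where $v(x_1,\dots,x_n)$ is the law of $((x_1,y_1),\dots,(x_n,y_n))$ with the $y_i\sim\sigma_i(x_i)$ independent. 3. For every context $[p,k]$, with $p\in D(\Theta\times\prod_jX_j)$ and $k:\Theta\times\prod_j(X_j\times Y_j)\to D(\mathbb R^n)$, and every $\sigma=(\sigma_1,\dots,\sigma_n)$, $$\mathrm{br}_{\mathcal A^{\Delta^n}}([p,k])(\sigma)=\prod_{i=1}^n\Big\{\tau_i:X_i\to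 D(Y_i)\ \Big|\ \forall x_i\in\mathrm{supp}\big((p^{\sigma_{-i}})_{X_i}\big):\ \tau_i(x_i)\in\arg\max_{\alpha_i\in D(Y_i)}\mathbb E\big[k^{\sigma_{-i}}(\mathcal U(p^{\sigma_{-i}})(x_i),\alpha_i)\big]\Big\}.$$ Here $p^{\sigma_{-i}}\in D\big((\Theta\times\prod_jX_j)\times X_i\big)$ is the law of $((\theta,x),x_i)$ for $(\theta,x)\sim p$, $(p^{\sigma_{-i}})_{X_i}$ is its $X_i$-marginal, and $k^{\sigma_{-i}}((\theta,x),y_i)$ is the law of the $i$-th coordinate of an outcome drawn from $k(\theta,(x_j,y_j)_j)$, where the $y_j\sim\sigma_j(x_j)$ for $j\neq i$ are independent. (c) Consider a Bayesian game with players $1,\dots,n$, finite action sets $Y_i$, type spaces $X_i$, common prior $\pi\in D(\prod_iX_i)$ and utilities $u_i:\prod_jY_j\times\prod_jX_j\to\mathbb R$. Let $c=[\pi,k]$ be the context with bound type $I$ and $k\big((x_j,y_j)_j\big)=\delta_{(u_1(y,x),\dots,u_n(y,x))}$. Then a mixed strategy profile $\sigma$ satisfies $\sigma\in\mathrm{br}_{\mathcal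 A^{\Delta^n}}(c)(\sigma)$ if and only if it is a Bayesian Nash equilibrium, i.e. for every $i$ the strategy $\sigma_i$ maximises, among all $\sigma_i':X_i\to D(Y_i)$, the ex ante expected utility of player $i$ against $\sigma_{-i}$. -/

import Mathlib

open Convexity

universe u

noncomputable section

namespace BayesGames

/-! ### Finitary distributions and random functions -/

/-- `D X`: finitely supported probability distributions on `X`. Random functions from `X` to `Y`,
the morphisms of the Kleisli category of `D`, are the functions `X → D Y`. -/
abbrev D (X : Type*) := StdSimplex ℝ X

/-- The set `ℝ` of outcomes, as a set in the universe of the types and actions. -/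
abbrev Outcome : Type u := ULift.{u} ℝ

namespace D

variable {X Y Z : Type*}

/-- The unit of `D`: the point mass. -/
def dirac (x : X) : D X := StdSimplex.single x

/-- The Kleisli extension of `f`, applied to `p`. -/
def bind (p : D X) (f : X → D Y) : D Y := p.iConvexComb f

/-- The support of a distribution. -/
def supp (p : D X) : Set X := {x | p.weights x ≠ 0}

theorem bind_weights (p : D X) (f : X → D Y) (y : Y) :
    (p.bind f).weights y = p.weights.sum fun x r => r * (f x).weights y := by
  refine (DFunLike.congr_fun (StdSimplex.weights_join (p.map f)) y).trans ?_
  rw [StdSimplex.weights_map, Finsupp.sum_mapDomain_index (by simp) (by simp [add_smul])]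
  simp only [Finsupp.sum, Finsupp.finsetSum_apply, Finsupp.smul_apply, smul_eq_mul]

theorem dirac_bind (x : X) (f : X → D Y) : (dirac x).bind f = f x := by
  simp [dirac, bind]

theorem bind_dirac (p : D X) : p.bind dirac = p := by
  classical
  ext y
  rw [bind_weights]
  simp only [dirac, StdSimplex.weights_single, Finsupp.sum, Finsupp.single_apply, mul_ite, mul_one,
    mul_zero, Finset.sum_ite_eq', Finsupp.mem_support_iff]
  exact ite_eq_left_iff.2 fun h => (not_not.1 h).symm

theorem bind_const (p : D X) (q : D Y) : (p.bind fun _ => q) = q := iConvexComb_const p q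

theorem bind_bind (p : D X) (f : X → D Y) (g : Y → D Z) :
    (p.bind f).bind g = p.bind fun x => (f x).bind g :=
  (iConvexComb_assoc p f g).symm

/-- `D` is commutative. -/
theorem bind_comm (p : D X) (q : D Y) (f : X → Y → D Z) :
    (p.bind fun x => q.bind fun y => f x y) = q.bind fun y => p.bind fun x => f x y :=
  iConvexComb_comm p q f

theorem map_eq_bind (p : D X) (f : X → Y) : p.map f = p.bind fun x => dirac (f x) := by
  ext y
  simp only [bind_weights, StdSimplex.weights_map, Finsupp.mapDomain, Finsupp.sum,
    Finsupp.finsetSum_apply, dirac, StdSimplex.weights_single]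
  classical
  simp [Finsupp.single_apply]

/-- The product of a finite family of distributions: the components are independent. -/
def pi {n : ℕ} {Y : Fin n → Type*} (p : ∀ i, D (Y i)) : D (∀ i, Y i) where
  weights := Finsupp.onFinset (Fintype.piFinset fun i => (p i).weights.support)
    (fun y => ∏ i, (p i).weights (y i)) (by
      intro y hy
      rw [Fintype.mem_piFinset]
      intro i
      rw [Finsupp.mem_support_iff]
      exact fun h => hy (Finset.prod_eq_zero (Finset.mem_univ i) h))
  nonneg := by
    intro y
    exact Finset.prod_nonneg (s := Finset.univ) (f := fun i => (p i).weights (y i))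
      fun i _ => (p i).nonneg (y i)
  total := by
    rw [Finsupp.onFinset_sum _ (fun _ => rfl),
      ← Finset.prod_univ_sum (fun i => (p i).weights.support) fun i y => (p i).weights y]
    exact Finset.prod_eq_one fun i _ => (p i).total

/-- The right marginal of a joint distribution. -/
def marginal (p : D (X × Y)) : D Y := p.map Prod.snd

theorem marginal_weights (p : D (X × Y)) (y : Y) :
    p.marginal.weights y = (p.weights.comapDomain (fun x => (x, y))
      (Prod.mk_left_injective y).injOn).sum fun _ r => r := by
  classical
  simp only [marginal, StdSimplex.weights_map, Finsupp.mapDomain, Finsupp.sum,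
    Finsupp.finsetSum_apply, Finsupp.single_apply, Finsupp.comapDomain_support,
    Finsupp.comapDomain_apply]
  rw [← Finset.sum_filter]
  refine (Finset.sum_bij (fun x _ => (x, y)) ?_ ?_ ?_ ?_).symm
  · intro x hx
    simpa using hx
  · intro a _ b _ h
    simpa using h
  · rintro ⟨x, z⟩ h
    simp only [Finset.mem_filter, Finsupp.mem_support_iff] at h
    obtain ⟨h1, rfl⟩ := h
    exact ⟨x, by simpa using h1, rfl⟩
  · intro x _
    rfl

/-- Bayesian updating: the posterior `p(θ | x) = p(θ, x) / ∑ θ', p(θ', x)`, defined at the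
observations `x` of positive probability. -/
def update {Θ : Type*} (p : D (Θ × X)) (x : X) (hx : x ∈ p.marginal.supp) : D Θ where
  weights := (p.marginal.weights x)⁻¹ • p.weights.comapDomain (fun θ => (θ, x))
    (Prod.mk_left_injective x).injOn
  nonneg := smul_nonneg (inv_nonneg.2 (p.marginal.nonneg x)) fun θ => p.nonneg (θ, x)
  total := by
    rw [Finsupp.sum_smul_index fun _ => rfl, ← Finsupp.mul_sum, ← marginal_weights,
      inv_mul_cancel₀ hx]

theorem update_weights {Θ : Type*} (p : D (Θ × X)) (x : X) (hx : x ∈ p.marginal.supp) (θ : Θ) :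
    (p.update x hx).weights θ = p.weights (θ, x) / p.marginal.weights x := by
  simp [update, div_eq_inv_mul]

/-- The expected value of a distribution of outcomes. -/
def expect (p : D Outcome.{u}) : ℝ := p.weights.sum fun r w => w * r.down

theorem marginal_slide {A B : Type*} (p : D (A × X)) (f : A → D B) :
    marginal (p.bind fun z => (f z.1).bind fun b => dirac (b, z.2)) = p.marginal := by
  simp only [marginal, map_eq_bind, bind_bind, dirac_bind]
  congr 1
  funext z
  exact bind_const _ _

theorem slide_weights {A B : Type*} (p : D (A × X)) (f : A → D B) (b : B) (x : X) :
    (p.bind fun z => (f z.1).bind fun b => dirac (b, z.2)).weights (b, x) =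
      (p.weights.comapDomain (fun a => (a, x)) (Prod.mk_left_injective x).injOn).sum
        fun a r => r * (f a).weights b := by
  classical
  rw [bind_weights]
  have key : ∀ z : A × X, ((f z.1).bind fun b => dirac (b, z.2)).weights (b, x) =
      if z.2 = x then (f z.1).weights b else 0 := by
    intro z
    rw [bind_weights]
    by_cases h : z.2 = x
    · simp only [dirac, StdSimplex.weights_single, Finsupp.single_apply, Prod.mk.injEq, h,
        and_true, if_true]
      simp [eq_comm]
    · simp [dirac, h]
  simp only [key, mul_ite, mul_zero]
  simp only [Finsupp.sum, Finsupp.comapDomain_support, Finsupp.comapDomain_apply]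
  rw [← Finset.sum_filter]
  refine (Finset.sum_bij (fun a _ => (a, x)) ?_ ?_ ?_ ?_).symm
  · intro a ha
    simpa using ha
  · intro a _ b _ h
    simpa using h
  · rintro ⟨a, z⟩ h
    simp only [Finset.mem_filter, Finsupp.mem_support_iff] at h
    obtain ⟨h1, rfl⟩ := h
    exact ⟨a, by simpa using h1, rfl⟩
  · intro a _
    rfl

/-- Updating is natural in the bound type, with respect to random functions. -/
theorem update_slide {A B : Type*} (p : D (A × X)) (f : A → D B) (x : X) (hx) (hx') :
    update (p.bind fun z => (f z.1).bind fun b => dirac (b, z.2)) x hx =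
      (p.update x hx').bind f := by
  ext b
  rw [update_weights, slide_weights, marginal_slide, bind_weights, update,
    Finsupp.sum_smul_index fun _ => zero_mul _, div_eq_inv_mul, Finsupp.mul_sum]
  simp only [mul_assoc]

end D

open D

/-! ### Coend lenses over the category of sets and random functions -/

/-- A pair `(v : X → A ⊗ Y, u : A ⊗ R → S)` of random functions with a bound type `A`. -/
structure LensRep (X S Y R : Type u) : Type (u + 1) where
  {A : Type u}
  v : X → D (A × Y)
  u : A × R → D S

/-- Sliding a random function `f : A → B` along the bound type. -/
inductive LensRep.Slide {X S Y R : Type u} : LensRep X S Y R → LensRep X S Y R → Prop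
  | slide {A B : Type u} (f : A → D B) (v : X → D (A × Y)) (u : B × R → D S) :
      Slide ⟨fun x => (v x).bind fun z => (f z.1).bind fun b => dirac (b, z.2), u⟩
        ⟨v, fun z => (f z.1).bind fun b => u (b, z.2)⟩

/-- Coend lenses `(X, S) → (Y, R)`: the quotient by the equivalence relation generated by
sliding. -/
def Lens (X S Y R : Type u) : Type (u + 1) := Quot (@LensRep.Slide X S Y R)

namespace Lens

variable {X S Y R Z Q X' S' Y' R' : Type u}

/-- The class `[v, u]` with bound type `A`. -/
def mk {A : Type u} (v : X → D (A × Y)) (u : A × R → D S) : Lens X S Y R := Quot.mk _ ⟨v, u⟩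

theorem sound {A B : Type u} (f : A → D B) {v : X → D (A × Y)} {v' : X → D (B × Y)}
    {u : B × R → D S} {u' : A × R → D S}
    (hv : ∀ x, v' x = (v x).bind fun z => (f z.1).bind fun b => dirac (b, z.2))
    (hu : ∀ z, u' z = (f z.1).bind fun b => u (b, z.2)) : mk v' u = mk v u' := by
  obtain rfl : v' = _ := funext hv
  obtain rfl : u' = _ := funext hu
  exact Quot.sound (.slide f v u)

/-- The lens `[f, g]` with bound type `I` given by functions `f : X → Y` and `g : R → S`. -/
def ofFun (f : X → Y) (g : R → S) : Lens X S Y R :=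
  mk (A := PUnit) (fun x => dirac (⟨⟩, f x)) fun z => dirac (g z.2)

/-- Composition of representatives, in diagrammatic order. -/
def compRep (l : LensRep X S Y R) (m : LensRep Y R Z Q) : Lens X S Z Q :=
  mk (A := l.A × m.A)
    (fun x => (l.v x).bind fun ay => (m.v ay.2).bind fun bz => dirac ((ay.1, bz.1), bz.2))
    fun z => (m.u (z.1.2, z.2)).bind fun r => l.u (z.1.1, r)

/-- Sequential composition of lenses, in diagrammatic order. -/
def comp (l : Lens X S Y R) (m : Lens Y R Z Q) : Lens X S Z Q :=
  Quot.liftOn₂ l m compRep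
    (by
      rintro l _ _ ⟨f, v, u⟩
      refine sound (fun z => (f z.2).bind fun b => dirac (z.1, b)) ?_ ?_
      · intro x; simp only [bind_bind, dirac_bind]
      · intro z; simp only [bind_bind, dirac_bind])
    (by
      rintro _ _ m ⟨f, v, u⟩
      refine sound (fun z => (f z.1).bind fun b => dirac (b, z.2)) ?_ ?_
      · intro x
        simp only [bind_bind, dirac_bind]
        congr 1; funext z; exact bind_comm _ _ _
      · intro z
        simp only [bind_bind, dirac_bind]
        exact bind_comm _ _ _)

/-- Tensor of representatives. -/
def tensorRep (l : LensRep X S Y R) (m : LensRep X' S' Y' R') :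
    Lens (X × X') (S × S') (Y × Y') (R × R') :=
  mk (A := l.A × m.A)
    (fun x => (l.v x.1).bind fun ay => (m.v x.2).bind fun bz =>
      dirac ((ay.1, bz.1), (ay.2, bz.2)))
    fun z => (l.u (z.1.1, z.2.1)).bind fun s => (m.u (z.1.2, z.2.2)).bind fun s' => dirac (s, s')

/-- Tensor composition of lenses. -/
def tensor (l : Lens X S Y R) (m : Lens X' S' Y' R') :
    Lens (X × X') (S × S') (Y × Y') (R × R') :=
  Quot.liftOn₂ l m tensorRep
    (by
      rintro l _ _ ⟨f, v, u⟩
      refine sound (fun z => (f z.2).bind fun b => dirac (z.1, b)) ?_ ?_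
      · intro x; simp only [bind_bind, dirac_bind]
      · intro z
        simp only [bind_bind, dirac_bind]
        exact bind_comm _ _ _)
    (by
      rintro _ _ m ⟨f, v, u⟩
      refine sound (fun z => (f z.1).bind fun b => dirac (b, z.2)) ?_ ?_
      · intro x
        simp only [bind_bind, dirac_bind]
        congr 1; funext z; exact bind_comm _ _ _
      · intro z; simp only [bind_bind, dirac_bind])

end Lens

/-! ### Contexts -/

/-- Contexts for games `(X, S) → (Y, R)` are the lenses `(I, R) → (X, Y)`. -/
abbrev Context (X Y R : Type u) : Type (u + 1) := Lens PUnit R X Y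

namespace Context

variable {X S Y R Z Q X' S' Y' R' : Type u}

/-- The context `[p, k]` with bound type `Θ`, for a state `p` of `Θ ⊗ X` and an outcome function
`k : Θ ⊗ Y → R`. -/
def mk {Θ : Type u} (p : D (Θ × X)) (k : Θ × Y → D R) : Context X Y R := Lens.mk (fun _ => p) k

theorem sound {Θ Θ' : Type u} (f : Θ → D Θ') {p : D (Θ × X)} {p' : D (Θ' × X)}
    {k : Θ' × Y → D R} {k' : Θ × Y → D R}
    (hp : p' = p.bind fun z => (f z.1).bind fun b => dirac (b, z.2))
    (hk : ∀ z, k' z = (f z.1).bind fun b => k (b, z.2)) : mk p' k = mk p k' :=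
  Lens.sound f (fun _ => hp) hk

/-- The local context of the first game in a sequential composite, when the second game is played
as `m`: play of `m` becomes part of the outcome function. -/
def seqLeft (c : Context X Z Q) (m : Lens Y R Z Q) : Context X Y R :=
  Quot.liftOn₂ c m
    (fun c m => mk (c.v ⟨⟩) fun z => (m.v z.2).bind fun bz =>
      (c.u (z.1, bz.2)).bind fun q => m.u (bz.1, q))
    (by
      rintro c _ _ ⟨f, v, u⟩
      refine congrArg (fun k => mk _ k) ?_
      funext z
      simp only [bind_bind, dirac_bind]
      congr 1; funext w; exact bind_comm _ _ _)
    (by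
      rintro _ _ m ⟨f, v, u⟩
      refine sound f rfl ?_
      intro z
      simp only [bind_bind]
      exact bind_comm _ _ _)

/-- The local context of the second game in a sequential composite, when the first game is played
as `l`: play of `l` becomes part of the state. -/
def seqRight (c : Context X Z Q) (l : Lens X S Y R) : Context Y Z Q :=
  Quot.liftOn₂ c l
    (fun c l => mk ((c.v ⟨⟩).bind fun z => (l.v z.2).bind fun ay => dirac (z.1, ay.2)) c.u)
    (by
      rintro c _ _ ⟨f, v, u⟩
      refine congrArg (fun p => mk p _) ?_
      congr 1; funext z
      simp only [bind_bind, dirac_bind]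
      congr 1; funext w
      exact bind_const _ _)
    (by
      rintro _ _ l ⟨f, v, u⟩
      refine sound f ?_ ?_
      · simp only [bind_bind, dirac_bind]
        congr 1; funext z; exact bind_comm _ _ _
      · intro z; rfl)

/-- The local context of the first game in a tensor composite, when the second game is played as
`m`: the output of `m` is kept in the bound type. -/
def tensorLeft (c : Context (X × X') (Y × Y') (R × R')) (m : Lens X' S' Y' R') : Context X Y R :=
  Quot.liftOn₂ c m
    (fun c m => mk
      ((c.v ⟨⟩).bind fun z => (m.v z.2.2).bind fun bz => dirac ((z.1, bz.2), z.2.1))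
      fun z => (c.u (z.1.1, (z.2, z.1.2))).bind fun r => dirac r.1)
    (by
      rintro c _ _ ⟨f, v, u⟩
      refine congrArg (fun p => mk p _) ?_
      congr 1; funext z
      simp only [bind_bind, dirac_bind]
      congr 1; funext w
      exact bind_const _ _)
    (by
      rintro _ _ m ⟨f, v, u⟩
      refine sound (fun z => (f z.1).bind fun b => dirac (b, z.2)) ?_ ?_
      · simp only [bind_bind, dirac_bind]
        congr 1; funext z; exact bind_comm _ _ _
      · intro z; simp only [bind_bind, dirac_bind])

/-- The local context of the second game in a tensor composite, when the first game is played as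
`l`. -/
def tensorRight (c : Context (X × X') (Y × Y') (R × R')) (l : Lens X S Y R) : Context X' Y' R' :=
  Quot.liftOn₂ c l
    (fun c l => mk
      ((c.v ⟨⟩).bind fun z => (l.v z.2.1).bind fun ay => dirac ((z.1, ay.2), z.2.2))
      fun z => (c.u (z.1.1, (z.1.2, z.2))).bind fun r => dirac r.2)
    (by
      rintro c _ _ ⟨f, v, u⟩
      refine congrArg (fun p => mk p _) ?_
      congr 1; funext z
      simp only [bind_bind, dirac_bind]
      congr 1; funext w
      exact bind_const _ _)
    (by
      rintro _ _ l ⟨f, v, u⟩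
      refine sound (fun z => (f z.1).bind fun b => dirac (b, z.2)) ?_ ?_
      · simp only [bind_bind, dirac_bind]
        congr 1; funext z; exact bind_comm _ _ _
      · intro z; simp only [bind_bind, dirac_bind])

end Context

/-! ### Bayesian open games -/

/-- A Bayesian open game `(X, S) → (Y, R)`. -/
structure OpenGame (X S Y R : Type u) : Type (u + 1) where
  /-- strategy profiles -/
  Strategy : Type u
  play : Strategy → Lens X S Y R
  /-- best response, a relation on strategy profiles for each context -/
  br : Context X Y R → Strategy → Set Strategy

namespace OpenGame

variable {X S Y R Z Q X' S' Y' R' : Type u}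

/-- The computation `⟨f, g⟩ : (X, S) → (Y, R)`, with one strategy. -/
def computation (f : X → Y) (g : R → S) : OpenGame X S Y R where
  Strategy := PUnit
  play _ := Lens.ofFun f g
  br _ _ := Set.univ

/-- Sequential composition, in diagrammatic order. -/
def seq (G : OpenGame X S Y R) (H : OpenGame Y R Z Q) : OpenGame X S Z Q where
  Strategy := G.Strategy × H.Strategy
  play s := (G.play s.1).comp (H.play s.2)
  br c s := G.br (Context.seqLeft c (H.play s.2)) s.1 ×ˢ H.br (Context.seqRight c (G.play s.1)) s.2

/-- Tensor composition. -/
def tensor (G : OpenGame X S Y R) (H : OpenGame X' S' Y' R') :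
    OpenGame (X × X') (S × S') (Y × Y') (R × R') where
  Strategy := G.Strategy × H.Strategy
  play s := (G.play s.1).tensor (H.play s.2)
  br c s := G.br (Context.tensorLeft c (H.play s.2)) s.1 ×ˢ H.br (Context.tensorRight c (G.play s.1)) s.2

/-- The `n`-fold tensor `G₁ ⊗ (G₂ ⊗ (⋯ ⊗ I))`, where the nested binary products are identified
with `n`-fold products of sets by composing with the evident structural isomorphisms. -/
def bigTensor : {n : ℕ} → {X S Y R : Fin n → Type u} →
    (∀ i, OpenGame (X i) (S i) (Y i) (R i)) → OpenGame (∀ i, X i) (∀ i, S i) (∀ i, Y i) (∀ i, R i)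
  | 0, _, _, _, _, _ => computation (fun _ i => i.elim0) fun _ i => i.elim0
  | _ + 1, _, _, _, _, G =>
    ((computation (fun x => (x 0, Fin.tail x)) fun s => Fin.cons s.1 s.2).seq
      ((G 0).tensor (bigTensor fun i => G i.succ))).seq
      (computation (fun y => Fin.cons y.1 y.2) fun r => (r 0, Fin.tail r))

end OpenGame

/-! ### Bayesian agents -/

/-- The points at which a real function is maximal. -/
def argmax {α : Type*} (f : α → ℝ) : Set α := {a | ∀ b, f b ≤ f a}

/-- The expected outcome `exp[k(q, α)]` under the belief `q` about the bound type and the random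
action `α`. -/
def expectedOutcome {Θ Y : Type u} (k : Θ × Y → D Outcome.{u}) (q : D Θ) (α : D Y) : ℝ :=
  expect (q.bind fun θ => α.bind fun y => k (θ, y))

/-- The strategies that, after every observation `x` in the support of the prior, maximise the
expected outcome under the updated prior. -/
def optimal {Θ X Y : Type u} (p : D (Θ × X)) (k : Θ × Y → D Outcome.{u}) : Set (X → D Y) :=
  {σ | ∀ x (hx : x ∈ p.marginal.supp),
    σ x ∈ argmax fun α : D Y => expectedOutcome k (p.update x hx) α}

/-- The preference function of a Bayesian agent. -/
def preference {X Y : Type u} (c : Context X Y Outcome.{u}) : Set (X → D Y) :=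
  Quot.liftOn c (fun c => optimal (c.v ⟨⟩) c.u) (by
    rintro _ _ ⟨f, v, u⟩
    have hm := marginal_slide (v ⟨⟩) f
    have key : ∀ x hx hx' (α : D Y),
        expectedOutcome u (update ((v ⟨⟩).bind fun z => (f z.1).bind fun b => dirac (b, z.2)) x hx)
          α = expectedOutcome (fun z => (f z.1).bind fun b => u (b, z.2))
            (update (v ⟨⟩) x hx') α := by
      intro x hx hx' α
      simp only [expectedOutcome]
      rw [update_slide _ _ _ hx hx', bind_bind]
      congr 2; funext a; exact bind_comm _ _ _
    ext σ
    constructor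
    · intro h x hx β
      have hx' : x ∈ (marginal ((v ⟨⟩).bind fun z => (f z.1).bind fun b => dirac (b, z.2))).supp :=
        hm ▸ hx
      simpa only [key x hx' hx] using h x hx' β
    · intro h x hx β
      have hx' : x ∈ (v ⟨⟩).marginal.supp := hm ▸ hx
      simpa only [key x hx hx'] using h x hx' β)

/-- The Bayesian agent `(X, I) → (Y, ℝ)`. -/
def agent (X Y : Type u) : OpenGame X PUnit Y Outcome.{u} where
  Strategy := X → D Y
  play σ := Lens.mk (A := PUnit) (fun x => (σ x).bind fun y => dirac (⟨⟩, y)) fun _ => dirac ⟨⟩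
  br c _ := preference c

/-- The type-copying Bayesian agent `(X, I) → (X × Y, ℝ)`: copy the type, then let the agent play
on one of the copies, in parallel with the identity on the other one. -/
def copyAgent (X Y : Type u) : OpenGame X PUnit (X × Y) Outcome.{u} :=
  ((OpenGame.computation (fun x => (x, x)) fun _ => ⟨⟩ :
      OpenGame X PUnit (X × X) (PUnit × PUnit)).seq
    ((OpenGame.computation id id : OpenGame X PUnit X PUnit).tensor (agent X Y))).seq
    (OpenGame.computation id fun r => (⟨⟩, r))

/-! ### The explicit descriptions -/

section Explicit

variable {n : ℕ} {X Y : Fin n → Type u} {Θ : Type u}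

/-- The play lens that copies every type `x i` and plays `σ i (x i)`, independently for the
different `i`; the coplay deletes all outcomes. -/
def explicitPlay (σ : ∀ i, X i → D (Y i)) :
    Lens (∀ i, X i) (Fin n → PUnit) (∀ i, X i × Y i) (Fin n → Outcome.{u}) :=
  Lens.mk (A := PUnit)
    (fun x => (D.pi fun i => σ i (x i)).bind fun y => dirac (⟨⟩, fun i => (x i, y i)))
    fun _ => dirac fun _ => ⟨⟩

/-- The state of the context of player `i`: the type of player `i` is copied, and all else is
kept in the bound type. -/
def localState (p : D (Θ × (∀ j, X j))) (i : Fin n) : D ((Θ × (∀ j, X j)) × X i) :=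
  p.bind fun z => dirac (z, z.2 i)

/-- The outcome function of the context of player `i`: the players `j ≠ i` play `σ j`, player `i`
plays the given action, and all outcomes but that of player `i` are deleted. -/
def localOutcome (k : Θ × (∀ j, X j × Y j) → D (Fin n → Outcome.{u}))
    (σ : ∀ j, X j → D (Y j)) (i : Fin n) : (Θ × (∀ j, X j)) × Y i → D Outcome.{u} :=
  fun w => (D.pi (Function.update (fun j => σ j (w.1.2 j)) i (dirac w.2))).bind fun y =>
    (k (w.1.1, fun j => (w.1.2 j, y j))).bind fun r => dirac (r i)

end Explicit

/-! ### Bayesian games -/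

/-- A Bayesian game with `n` players, finite sets `A i` of actions, type spaces `Θ i`, a common
prior and utility functions. -/
structure BayesianGame (n : ℕ) (A Θ : Fin n → Type u) [∀ i, Fintype (A i)] where
  prior : D (∀ i, Θ i)
  utility : Fin n → (∀ i, A i) → (∀ i, Θ i) → ℝ

namespace BayesianGame

variable {n : ℕ} {A Θ : Fin n → Type u} [∀ i, Fintype (A i)] (B : BayesianGame n A Θ)

/-- Ex post expected utility. -/
def exPost (i : Fin n) (s : ∀ j, Θ j → D (A j)) (θ : ∀ j, Θ j) : ℝ :=
  ∑ a : ∀ j, A j, (∏ j, (s j (θ j)).weights (a j)) * B.utility i a θ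

/-- Ex ante expected utility. -/
def exAnte (i : Fin n) (s : ∀ j, Θ j → D (A j)) : ℝ :=
  B.prior.weights.sum fun θ w => w * B.exPost i s θ

/-- Bayesian Nash equilibrium: every `s i` is a best response to the other strategies, that is, it
maximises the ex ante expected utility of player `i`. -/
def IsBayesianNash (s : ∀ j, Θ j → D (A j)) : Prop :=
  ∀ i, s i ∈ argmax fun t : Θ i → D (A i) => B.exAnte i (Function.update s i t)

/-- The context given by the prior and the utility functions. -/
def context : Context (∀ i, Θ i) (∀ i, Θ i × A i) (Fin n → Outcome.{u}) :=
  Context.mk (Θ := PUnit) (B.prior.bind fun θ => dirac (⟨⟩, θ)) fun z =>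
    dirac fun i => ⟨B.utility i (fun j => (z.2 j).2) fun j => (z.2 j).1⟩

end BayesianGame

end BayesGames

end

namespace BayesGames

open D

/-! ### Independent products of distributions -/

namespace D

/-! The central point is that the local contexts produced by composition and those in the statement
are different representatives of one coend class. In a binary tensor, the local context of one
player samples the other player's output and stores it in the bound type. The explicit description
keeps only the prior in the bound type and leaves the sampling to the outcome function. Sliding the
random function "the others play" along the bound type passes from one to the other. Since
`preference` is defined on the quotient (posteriors are natural under random functions of the bound
type), the best responses agree.

Part (a) needs only normal forms for composites with structural lenses: the identity wire stores the
copied type in the bound type. Part (b) is an induction on the number of players, `play_bigTensor`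
for play and `mem_bigTensor_br` for best response, with one slide for the head and one for the tail.

For (c), conditioning on the player's own type (`mean_eq_sum_update`) writes ex ante utility as a
sum, over types of positive probability, of that probability times interim utility. The strategy can
be chosen separately at each type, so maximising the sum is maximising every summand
(`mem_optimal_iff`). `pi_update` identifies the sum with the usual ex ante utility. -/

theorem pi_weights {n : ℕ} {Y : Fin n → Type*} (p : ∀ i, D (Y i)) (y : ∀ i, Y i) :
    (D.pi p).weights y = ∏ i, (p i).weights (y i) := rfl

theorem pi_zero {Y : Fin 0 → Type*} (p : ∀ i, D (Y i)) (y : ∀ i, Y i) : D.pi p = dirac y := by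
  refine StdSimplex.ext (Finsupp.ext fun z => ?_)
  rw [Subsingleton.elim z y, pi_weights, dirac, StdSimplex.weights_single, Finsupp.single_eq_same,
    Finset.univ_eq_empty, Finset.prod_empty]

/-- A product of distributions is sampled by sampling the first component and then the others. -/
theorem pi_succ {n : ℕ} {Y : Fin (n + 1) → Type*} (p : ∀ i, D (Y i)) :
    D.pi p = (p 0).bind fun a => (D.pi fun i => p i.succ).bind fun b => dirac (Fin.cons a b) := by
  classical
  ext y
  have inner : ∀ a, ((D.pi fun i => p i.succ).bind
      fun b => dirac (Fin.cons a b : ∀ i, Y i)).weights y =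
      if a = y 0 then (D.pi fun i => p i.succ).weights (Fin.tail y) else 0 := by
    intro a
    rw [bind_weights]
    have : ∀ b, (dirac (Fin.cons a b : ∀ i, Y i)).weights y =
        if a = y 0 ∧ b = Fin.tail y then 1 else 0 := by
      intro b
      rw [dirac, StdSimplex.weights_single, Finsupp.single_apply]
      refine if_congr ?_ rfl rfl
      constructor
      · rintro rfl; simp
      · rintro ⟨rfl, rfl⟩; exact Fin.cons_self_tail y
    simp only [this]
    split_ifs with h
    · simp only [h, true_and, mul_ite, mul_one, mul_zero, Finsupp.sum, Finset.sum_ite_eq',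
        Finsupp.mem_support_iff]
      exact ite_eq_left_iff.2 fun h => (not_not.1 h).symm
    · simp [h]
  rw [bind_weights]
  simp only [inner, mul_ite, mul_zero, Finsupp.sum, Finset.sum_ite_eq', Finsupp.mem_support_iff]
  rw [pi_weights, pi_weights, Fin.prod_univ_succ]
  split_ifs with h
  · rfl
  -- The outer sum runs over the support of `p 0`; if `y 0` lies outside it, both sides vanish.
  · rw [not_not.1 h, zero_mul]

end D

/-! ### Composites with structural lenses in normal form -/

namespace Lens

variable {X S Y R Z Q X' S' Y' R' : Type u}

/-- The composite has bound type `PUnit × A`; sliding along `a ↦ (⟨⟩, a)` removes the trivial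
factor. The next two composites with `ofFun` work the same way. -/
theorem ofFun_comp_mk {A : Type u} (f : X → Y) (g : R → S) (v : Y → D (A × Z)) (u : A × Q → D R) :
    (ofFun f g).comp (mk v u) = mk (fun x => v (f x)) fun z => (u z).bind fun r => dirac (g r) := by
  refine sound (A := A) (fun a => dirac (⟨⟩, a)) (fun x => ?_) fun z => ?_ <;>
  simp only [dirac_bind]

theorem mk_comp_ofFun {A : Type u} (v : X → D (A × Y)) (u : A × R → D S) (f : Y → Z) (g : Q → R) :
    (mk v u).comp (ofFun f g) =
      mk (fun x => (v x).bind fun z => dirac (z.1, f z.2)) fun z => u (z.1, g z.2) := by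
  refine sound (A := A) (fun a => dirac (a, ⟨⟩)) (fun x => ?_) fun z => ?_ <;>
  simp only [dirac_bind, bind_bind]

theorem mk_tensor_mk {A B : Type u} (v : X → D (A × Y)) (u : A × R → D S)
    (v' : X' → D (B × Y')) (u' : B × R' → D S') :
    (mk v u).tensor (mk v' u') = mk
      (fun x => (v x.1).bind fun ay => (v' x.2).bind fun bz => dirac ((ay.1, bz.1), (ay.2, bz.2)))
      fun z => (u (z.1.1, z.2.1)).bind fun s => (u' (z.1.2, z.2.2)).bind fun s' => dirac (s, s') :=
  rfl

theorem ofFun_tensor_mk {A : Type u} (f : X → Y) (g : R → S) (v : X' → D (A × Y'))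
    (u : A × R' → D S') :
    (ofFun f g).tensor (mk v u) = mk
      (fun x => (v x.2).bind fun z => dirac (z.1, (f x.1, z.2)))
      fun z => (u (z.1, z.2.2)).bind fun s => dirac (g z.2.1, s) := by
  refine sound (A := A) (fun a => dirac (⟨⟩, a)) (fun x => ?_) fun z => ?_ <;>
  simp only [dirac_bind, bind_bind]

end Lens

/-! ### Local contexts beside structural lenses -/

namespace Context

variable {X S Y R Z Q X' S' Y' R' Θ A : Type u}

/-- A local context never absorbs the bound type of the neighbouring lens, so no slide is needed:
evaluating point masses already makes the representatives equal. This also covers the other `ofFun`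
cases below. -/
theorem mk_seqLeft_ofFun (p : D (Θ × X)) (k : Θ × Z → D Q) (f : Y → Z) (g : Q → R) :
    seqLeft (mk p k) (Lens.ofFun f g) =
      mk p fun z => (k (z.1, f z.2)).bind fun q => dirac (g q) := by
  refine congrArg (mk p) (funext fun z => ?_)
  simp only [dirac_bind]

theorem mk_seqRight_ofFun (p : D (Θ × X)) (k : Θ × Z → D Q) (f : X → Y) (g : R → S) :
    seqRight (mk p k) (Lens.ofFun f g) = mk (p.bind fun z => dirac (z.1, f z.2)) k := by
  refine congrArg (mk · k) ?_
  simp only [dirac_bind]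

theorem mk_tensorLeft_mk (p : D (Θ × (X × X'))) (k : Θ × (Y × Y') → D (R × R'))
    (v : X' → D (A × Y')) (u : A × R' → D S') :
    tensorLeft (mk p k) (Lens.mk v u) =
      mk (p.bind fun z => (v z.2.2).bind fun bz => dirac ((z.1, bz.2), z.2.1))
        fun z => (k (z.1.1, (z.2, z.1.2))).bind fun r => dirac r.1 :=
  rfl

theorem mk_tensorRight_mk (p : D (Θ × (X × X'))) (k : Θ × (Y × Y') → D (R × R'))
    (v : X → D (A × Y)) (u : A × R → D S) :
    tensorRight (mk p k) (Lens.mk v u) =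
      mk (p.bind fun z => (v z.2.1).bind fun ay => dirac ((z.1, ay.2), z.2.2))
        fun z => (k (z.1.1, (z.1.2, z.2))).bind fun r => dirac r.2 :=
  rfl

theorem mk_tensorRight_ofFun (p : D (Θ × (X × X'))) (k : Θ × (Y × Y') → D (R × R'))
    (f : X → Y) (g : R → S) :
    tensorRight (mk p k) (Lens.ofFun f g) =
      mk (p.bind fun z => dirac ((z.1, f z.2.1), z.2.2))
        fun z => (k (z.1.1, (z.1.2, z.2))).bind fun r => dirac r.2 := by
  refine congrArg (mk · _) ?_
  simp only [dirac_bind]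

end Context

/-! ### Play and best response of composites with computations -/

namespace OpenGame

variable {X S Y R Z Q X' S' Y' R' : Type u}

theorem play_computation_seq (f : X → Y) (g : R → S) (G : OpenGame Y R Z Q)
    (s : ((computation f g).seq G).Strategy) :
    ((computation f g).seq G).play s = (Lens.ofFun f g).comp (G.play s.2) := rfl

theorem play_seq_computation (G : OpenGame X S Y R) (f : Y → Z) (g : Q → R)
    (s : (G.seq (computation f g)).Strategy) :
    (G.seq (computation f g)).play s = (G.play s.1).comp (Lens.ofFun f g) := rfl

theorem play_tensor (G : OpenGame X S Y R) (H : OpenGame X' S' Y' R')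
    (s : (G.tensor H).Strategy) :
    (G.tensor H).play s = (G.play s.1).tensor (H.play s.2) := rfl

/-- The only strategy of a computation is always a best response, so its factor of the product
imposes no condition. -/
theorem mem_computation_seq_br (f : X → Y) (g : R → S) (G : OpenGame Y R Z Q) (c : Context X Z Q)
    (s t : ((computation f g).seq G).Strategy) :
    t ∈ ((computation f g).seq G).br c s ↔
      t.2 ∈ G.br (Context.seqRight c (Lens.ofFun f g)) s.2 :=
  iff_of_eq (true_and _)

theorem mem_seq_computation_br (G : OpenGame X S Y R) (f : Y → Z) (g : Q → R) (c : Context X Z Q)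
    (s t : (G.seq (computation f g)).Strategy) :
    t ∈ (G.seq (computation f g)).br c s ↔
      t.1 ∈ G.br (Context.seqLeft c (Lens.ofFun f g)) s.1 :=
  iff_of_eq (and_true _)

theorem mem_tensor_br (G : OpenGame X S Y R) (H : OpenGame X' S' Y' R')
    (c : Context (X × X') (Y × Y') (R × R')) (s t : (G.tensor H).Strategy) :
    t ∈ (G.tensor H).br c s ↔
      t.1 ∈ G.br (Context.tensorLeft c (H.play s.2)) s.1 ∧
        t.2 ∈ H.br (Context.tensorRight c (G.play s.1)) s.2 := Iff.rfl

theorem play_computation (f : X → Y) (g : R → S) (s : (computation f g).Strategy) :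
    (computation f g).play s = Lens.ofFun f g := rfl

theorem mem_computation_br (f : X → Y) (g : R → S) (c : Context X Y R)
    (s t : (computation f g).Strategy) : t ∈ (computation f g).br c s := trivial

end OpenGame

theorem play_agent {X Y : Type u} (σ : X → D Y) :
    (agent X Y).play σ =
      Lens.mk (A := PUnit) (fun x => (σ x).bind fun y => dirac (⟨⟩, y)) fun _ => dirac ⟨⟩ := rfl

theorem mem_agent_br {X Y : Type u} (c : Context X Y Outcome.{u}) (σ : (agent X Y).Strategy)
    (τ : X → D Y) : τ ∈ (agent X Y).br c σ ↔ τ ∈ preference c := Iff.rfl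

/-! ### The type-copying agent -/

section CopyAgent

variable (X Y : Type u)

/-- The strategies of the type-copying agent are those of the agent. -/
def copyAgentEquiv : (copyAgent X Y).Strategy ≃ (X → D Y) :=
  (Equiv.prodPUnit _).trans ((Equiv.punitProd _).trans (Equiv.punitProd _))

variable {X Y}

theorem copyAgent_play (s : (copyAgent X Y).Strategy) :
    (copyAgent X Y).play s =
      Lens.mk (A := PUnit) (fun x => (copyAgentEquiv X Y s x).bind fun y => dirac (⟨⟩, (x, y)))
        fun _ => dirac ⟨⟩ := by
  refine (OpenGame.play_seq_computation _ _ _ s).trans ?_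
  rw [OpenGame.play_computation_seq, OpenGame.play_tensor, OpenGame.play_computation,
    -- The component `s.1.2.2` is the agent's own strategy, definitionally the value of
    -- `copyAgentEquiv`.
    show (agent X Y).play s.1.2.2 = _ from play_agent (copyAgentEquiv X Y s),
    Lens.ofFun_tensor_mk, Lens.ofFun_comp_mk, Lens.mk_comp_ofFun]
  simp only [bind_bind, dirac_bind, id]

theorem mem_copyAgent_br {Θ : Type u} (p : D (Θ × X)) (k : Θ × (X × Y) → D Outcome.{u})
    (s t : (copyAgent X Y).Strategy) :
    t ∈ (copyAgent X Y).br (Context.mk p k) s ↔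
      copyAgentEquiv X Y t ∈ preference
        (Context.mk (p.bind fun z => dirac (z, z.2)) fun w => k (w.1.1, (w.1.2, w.2))) := by
  refine (OpenGame.mem_seq_computation_br _ _ _ _ s t).trans ?_
  rw [OpenGame.mem_computation_seq_br,
    OpenGame.mem_tensor_br, and_iff_right (OpenGame.mem_computation_br _ _ _ _ _),
    OpenGame.play_computation, Context.mk_seqLeft_ofFun, Context.mk_seqRight_ofFun,
    Context.mk_tensorRight_ofFun]
  refine (mem_agent_br _ s.1.2.2 (copyAgentEquiv X Y t)).trans ?_
  refine iff_of_eq (congrArg (copyAgentEquiv X Y t ∈ preference ·) ?_)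
  simp only [bind_bind, dirac_bind, id]
  -- Pairing an outcome with the trivial one and projecting back leaves a bind with `dirac`.
  exact congrArg (Context.mk _) (funext fun _ => bind_dirac _)

end CopyAgent

/-! ### The n-fold tensor, by induction on the number of players -/

section BigTensor

/-- A strategy of the tensor of type-copying agents is a family of strategies of the agents. -/
def bigTensorEquiv : {n : ℕ} → (X Y : Fin n → Type u) →
    ((OpenGame.bigTensor fun i => copyAgent (X i) (Y i)).Strategy ≃ (∀ i, X i → D (Y i)))
  | 0, X, Y => (Equiv.ofUnique PUnit.{u + 1} (∀ i, X i → D (Y i)))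
  | _ + 1, X, Y =>
    (Equiv.prodPUnit _).trans <| (Equiv.punitProd _).trans <|
      ((copyAgentEquiv (X 0) (Y 0)).prodCongr
        (bigTensorEquiv (fun i => X i.succ) fun i => Y i.succ)).trans
      (Fin.consEquiv fun i => X i → D (Y i))

variable {n : ℕ}

section

variable {X Y : Fin (n + 1) → Type u}

theorem play_bigTensor_succ
    (s : (OpenGame.bigTensor fun i => copyAgent (X i) (Y i)).Strategy) :
    (OpenGame.bigTensor fun i => copyAgent (X i) (Y i)).play s =
      ((Lens.ofFun (fun x => (x 0, Fin.tail x)) fun s => Fin.cons s.1 s.2).comp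
        (((copyAgent (X 0) (Y 0)).play s.1.2.1).tensor
          ((OpenGame.bigTensor fun i : Fin n => copyAgent (X i.succ) (Y i.succ)).play
            s.1.2.2))).comp
      (Lens.ofFun (fun y => Fin.cons y.1 y.2) fun r => (r 0, Fin.tail r)) := rfl

theorem mem_bigTensor_succ_br {Θ : Type u} (p : D (Θ × (∀ i, X i)))
    (k : Θ × (∀ i, X i × Y i) → D (Fin (n + 1) → Outcome.{u}))
    (s t : (OpenGame.bigTensor fun i => copyAgent (X i) (Y i)).Strategy) :
    t ∈ (OpenGame.bigTensor fun i => copyAgent (X i) (Y i)).br (Context.mk p k) s ↔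
      t.1.2 ∈ ((copyAgent (X 0) (Y 0)).tensor
        (OpenGame.bigTensor fun i : Fin n => copyAgent (X i.succ) (Y i.succ))).br
          (Context.mk (p.bind fun z => dirac (z.1, (z.2 0, Fin.tail z.2)))
            fun z => (k (z.1, Fin.cons z.2.1 z.2.2)).bind fun r => dirac (r 0, Fin.tail r))
          s.1.2 := by
  refine (OpenGame.mem_seq_computation_br _ _ _ _ s t).trans ?_
  rw [OpenGame.mem_computation_seq_br, Context.mk_seqLeft_ofFun, Context.mk_seqRight_ofFun]

end

theorem pair_cons {X Y : Fin (n + 1) → Type u} (x : ∀ i, X i) (a : Y 0)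
    (b : ∀ i : Fin n, Y i.succ) :
    (fun i => (x i, (Fin.cons a b : ∀ i, Y i) i)) =
      (Fin.cons (x 0, a) fun i => (x i.succ, b i) : ∀ i, X i × Y i) := by
  funext i
  cases i using Fin.cases <;> rfl

theorem explicitPlay_succ {X Y : Fin (n + 1) → Type u} (σ : ∀ i, X i → D (Y i)) :
    explicitPlay σ = Lens.mk (A := PUnit)
      (fun x => (σ 0 (x 0)).bind fun a => (D.pi fun i => σ i.succ (x i.succ)).bind fun b =>
        dirac (⟨⟩, Fin.cons (x 0, a) fun i => (x i.succ, b i)))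
      fun _ => dirac fun _ => ⟨⟩ := by
  refine congrArg (Lens.mk · _) (funext fun x => ?_)
  rw [pi_succ]
  simp only [bind_bind, dirac_bind, pair_cons]

section

variable {X Y : Fin (n + 1) → Type u} {Θ : Type u}
  (k : Θ × (∀ j, X j × Y j) → D (Fin (n + 1) → Outcome.{u})) (σ : ∀ j, X j → D (Y j))

theorem localOutcome_zero (w : (Θ × (∀ j, X j)) × Y 0) :
    localOutcome k σ 0 w = (D.pi fun i : Fin n => σ i.succ (w.1.2 i.succ)).bind fun b =>
      (k (w.1.1, Fin.cons (w.1.2 0, w.2) fun i => (w.1.2 i.succ, b i))).bind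
        fun r => dirac (r 0) := by
  have h : (fun i : Fin n =>
      Function.update (fun j => σ j (w.1.2 j)) 0 (dirac w.2) i.succ) =
      fun i : Fin n => σ i.succ (w.1.2 i.succ) :=
    Fin.tail_update_zero (fun j => σ j (w.1.2 j)) (dirac w.2)
  rw [localOutcome, pi_succ, Function.update_self, h]
  simp only [bind_bind, dirac_bind, pair_cons]

/-- Sampling player 0 first and storing its type and action in the bound type leaves a local outcome
function of the tail game. This is the outcome half of the slide in the tail case of
`mem_bigTensor_br`. -/
theorem localOutcome_succ (i : Fin n) (w : (Θ × (∀ j, X j)) × Y i.succ) :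
    localOutcome k σ i.succ w = (σ 0 (w.1.2 0)).bind fun a =>
      localOutcome
        (fun z : (Θ × (X 0 × Y 0)) × (∀ j : Fin n, X j.succ × Y j.succ) =>
          (k (z.1.1, Fin.cons z.1.2 z.2)).bind fun r => dirac (Fin.tail r))
        (fun j => σ j.succ) i (((w.1.1, (w.1.2 0, a)), Fin.tail w.1.2), w.2) := by
  have h : (fun j : Fin n =>
      Function.update (fun j => σ j (w.1.2 j)) i.succ (dirac w.2) j.succ) =
      Function.update (fun j : Fin n => σ j.succ (w.1.2 j.succ)) i (dirac w.2) :=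
    Fin.tail_update_succ (fun j => σ j (w.1.2 j)) i (dirac w.2)
  rw [localOutcome, pi_succ, Function.update_of_ne (Fin.succ_ne_zero i).symm, h]
  simp only [localOutcome, bind_bind, dirac_bind, pair_cons]
  rfl

end

theorem play_bigTensor : ∀ {n : ℕ} (X Y : Fin n → Type u)
    (s : (OpenGame.bigTensor fun i => copyAgent (X i) (Y i)).Strategy),
    (OpenGame.bigTensor fun i => copyAgent (X i) (Y i)).play s =
      explicitPlay (bigTensorEquiv X Y s)
  | 0, X, Y, s => by
    refine congrArg₂ Lens.mk (funext fun x => ?_) (funext fun z => congrArg dirac ?_)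
    · rw [pi_zero _ fun i => i.elim0, dirac_bind]
      exact congrArg (fun y => dirac (PUnit.unit, y)) (funext fun i => i.elim0)
    · exact funext fun i => i.elim0
  | n + 1, X, Y, s => by
    rw [play_bigTensor_succ, copyAgent_play, play_bigTensor, explicitPlay_succ, explicitPlay,
      Lens.mk_tensor_mk, Lens.ofFun_comp_mk, Lens.mk_comp_ofFun]
    -- The tensor has bound type `PUnit × PUnit`, the explicit lens `PUnit`.
    refine Lens.sound (fun _ => dirac (⟨⟩, ⟨⟩)) (fun x => ?_) fun z => ?_
    · simp only [bind_bind, dirac_bind]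
      rfl
    · simp only [dirac_bind]

/-- The other players' sampling slides from the state to the outcome function. The bound type `Θ`
varies in the induction because the tail's context has the larger bound type `Θ × (X 0 × Y 0)`. -/
theorem mem_bigTensor_br : ∀ {n : ℕ} (X Y : Fin n → Type u) {Θ : Type u}
    (p : D (Θ × (∀ i, X i))) (k : Θ × (∀ i, X i × Y i) → D (Fin n → Outcome.{u}))
    (s t : (OpenGame.bigTensor fun i => copyAgent (X i) (Y i)).Strategy),
    t ∈ (OpenGame.bigTensor fun i => copyAgent (X i) (Y i)).br (Context.mk p k) s ↔
      ∀ i, bigTensorEquiv X Y t i ∈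
        preference (Context.mk (localState p i) (localOutcome k (bigTensorEquiv X Y s) i))
  | 0, X, Y, Θ, p, k, s, t => iff_of_true trivial fun i => i.elim0
  | n + 1, X, Y, Θ, p, k, s, t => by
    rw [mem_bigTensor_succ_br, OpenGame.mem_tensor_br, play_bigTensor, copyAgent_play,
      Fin.forall_fin_succ]
    refine and_congr ?_ ?_
    · rw [explicitPlay, Context.mk_tensorLeft_mk, mem_copyAgent_br]
      refine iff_of_eq (congrArg₂ (· ∈ preference ·) rfl ?_)
      -- Slide the play of players 1, …, n, retaining `Θ`, their types and actions, and the copied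
      -- type of player 0.
      refine Context.sound (fun z => (D.pi fun i : Fin n =>
        bigTensorEquiv X Y s i.succ (z.2 i.succ)).bind fun y =>
          dirac ((z.1, fun i => (z.2 i.succ, y i)), z.2 0)) ?_ fun z => ?_
      · simp only [localState, bind_bind, dirac_bind]
        rfl
      · simp only [localOutcome_zero, bind_bind, dirac_bind]
    · rw [Context.mk_tensorRight_mk]
      refine (mem_bigTensor_br _ _ _ _ _ _).trans (forall_congr' fun i => ?_)
      refine iff_of_eq (congrArg₂ (· ∈ preference ·) rfl ?_)
      -- Slide the play of player 0 alone; the induction hypothesis has already moved the other tail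
      -- players into the outcome function.
      refine Context.sound (fun z => (bigTensorEquiv X Y s 0 (z.2 0)).bind fun y =>
          dirac ((z.1, (z.2 0, y)), Fin.tail z.2)) ?_ fun z => ?_
      · simp only [localState, bind_bind, dirac_bind]
        rfl
      · simp only [localOutcome_succ, bind_bind, dirac_bind]
        simp only [localOutcome, bind_bind, dirac_bind]
        rfl

end BigTensor

/-! ### Conditional means; interim and ex ante optimality -/

section Mean

variable {X Y : Type*}

namespace D

/-- The mean of a real function under a distribution. -/
def mean (p : D X) (g : X → ℝ) : ℝ := p.weights.sum fun x w => w * g x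

theorem mean_dirac (x : X) (g : X → ℝ) : (dirac x).mean g = g x := by
  simp [mean, dirac]

theorem mean_bind (p : D X) (f : X → D Y) (g : Y → ℝ) :
    (p.bind f).mean g = p.mean fun x => (f x).mean g := by
  have h : (p.bind f).weights = p.weights.sum fun x r => r • (f x).weights := by
    ext y
    rw [bind_weights]
    simp only [Finsupp.sum, Finsupp.finsetSum_apply, Finsupp.smul_apply, smul_eq_mul]
  simp only [mean, h]
  rw [Finsupp.sum_sum_index (fun _ => zero_mul _) fun _ _ _ => add_mul _ _ _]
  refine Finsupp.sum_congr fun x _ => ?_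
  rw [Finsupp.sum_smul_index fun _ => zero_mul _, Finsupp.mul_sum]
  simp only [mul_assoc]

theorem expect_eq_mean (p : D Outcome.{u}) : expect p = p.mean ULift.down := rfl

theorem mean_fintype [Fintype X] (p : D X) (g : X → ℝ) :
    p.mean g = ∑ x, p.weights x * g x :=
  Finsupp.sum_fintype _ _ fun _ => zero_mul _

/-- A nonnegative sum dominates each of its terms. Hence the joint support projects into the support
of the marginal, where posteriors exist. -/
theorem weights_le_marginal (p : D (X × Y)) (z : X × Y) :
    p.weights z ≤ p.marginal.weights z.2 := by
  rw [marginal_weights]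
  by_cases hz : p.weights z = 0
  · rw [hz]
    exact Finset.sum_nonneg fun x _ => p.nonneg (x, z.2)
  · exact Finset.single_le_sum (s := (p.weights.comapDomain (fun x => (x, z.2)) _).support)
      (f := fun x => p.weights (x, z.2)) (fun x _ => p.nonneg (x, z.2))
      (Finsupp.mem_support_iff.2 hz)

open Classical in
/-- A mean is computed by averaging conditional means. -/
theorem mean_eq_sum_update {Θ : Type*} (p : D (Θ × X)) (g : Θ × X → ℝ) :
    p.mean g = p.marginal.mean fun x =>
      if hx : x ∈ p.marginal.supp then (p.update x hx).mean fun θ => g (θ, x) else 0 := by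
  -- Enlarging the support to a rectangle allows summation over `θ` for fixed `x`.
  have hsub : p.weights.support ⊆
      p.weights.support.image Prod.fst ×ˢ p.marginal.weights.support := by
    intro z hz
    rw [Finset.mem_product]
    refine ⟨Finset.mem_image_of_mem _ hz, ?_⟩
    rw [Finsupp.mem_support_iff] at hz ⊢
    exact (((p.nonneg z).lt_of_ne' hz).trans_le (p.weights_le_marginal z)).ne'
  rw [mean, Finsupp.sum_of_support_subset _ hsub (fun z w => w * g z) fun _ _ => zero_mul _,
    Finset.sum_product_right, mean, Finsupp.sum]
  refine Finset.sum_congr rfl fun x hx => ?_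
  have hx' : x ∈ p.marginal.supp := Finsupp.mem_support_iff.1 hx
  have hup : (p.update x hx').weights.support ⊆ p.weights.support.image Prod.fst := by
    intro θ hθ
    rw [Finsupp.mem_support_iff, update_weights] at hθ
    exact Finset.mem_image_of_mem Prod.fst
      (Finsupp.mem_support_iff.2 fun h : p.weights (θ, x) = 0 => hθ (by rw [h, zero_div]))
  rw [dif_pos hx', mean,
    Finsupp.sum_of_support_subset _ hup (fun θ w => w * g (θ, x)) fun _ _ => zero_mul _,
    Finset.mul_sum]
  refine Finset.sum_congr rfl fun θ _ => ?_
  -- The normalising constant of the posterior cancels the marginal weight.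
  rw [update_weights, ← mul_assoc, mul_div_cancel₀ _ hx']

/-- Sampling a product of distributions can begin with any one of its components. -/
theorem pi_update {n : ℕ} {Y : Fin n → Type*} (q : ∀ i, D (Y i)) (i : Fin n) (r : D (Y i)) :
    D.pi (Function.update q i r) =
      r.bind fun y => D.pi (Function.update q i (dirac y)) := by
  classical
  obtain _ | n := n
  · exact i.elim0
  refine StdSimplex.ext (Finsupp.ext fun y => ?_)
  -- The component `r` enters only through the factor `r.weights (y i)`; the remaining product does
  -- not depend on it.
  have h : ∀ r : D (Y i), (D.pi (Function.update q i r)).weights y =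
      r.weights (y i) * ∏ j, (q (i.succAbove j)).weights (y (i.succAbove j)) := by
    intro r
    rw [pi_weights, Fin.prod_univ_succAbove _ i, Function.update_self]
    simp only [Function.update_of_ne (Fin.succAbove_ne i _)]
  rw [bind_weights]
  simp only [h]
  simp only [← mul_assoc]
  rw [← Finsupp.sum_mul, ← bind_weights, bind_dirac]

end D

theorem expectedOutcome_eq_mean {Θ Y : Type u} (k : Θ × Y → D Outcome.{u}) (q : D Θ) (α : D Y) :
    expectedOutcome k q α = q.mean fun θ => α.mean fun y => expect (k (θ, y)) := by
  simp only [expectedOutcome, expect_eq_mean, mean_bind]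

open Classical in
/-- Maximising the interim expected outcome after every observation of positive probability is
the same as maximising the ex ante expected outcome. -/
theorem mem_optimal_iff {Θ X Y : Type u} (p : D (Θ × X)) (k : Θ × Y → D Outcome.{u})
    (σ : X → D Y) :
    σ ∈ optimal p k ↔
      σ ∈ argmax fun t : X → D Y => p.mean fun z => (t z.2).mean fun y => expect (k (z.1, y)) := by
  -- The interim value; the default 0 is harmless, as only `x` in the support of the marginal occur
  -- below.
  set V : X → D Y → ℝ := fun x α =>
    if hx : x ∈ p.marginal.supp then expectedOutcome k (p.update x hx) α else 0 with hV
  have hmean : ∀ t : X → D Y, (p.mean fun z => (t z.2).mean fun y => expect (k (z.1, y))) =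
      ∑ x ∈ p.marginal.weights.support, p.marginal.weights x * V x (t x) := by
    intro t
    rw [mean_eq_sum_update]
    simp only [hV, expectedOutcome_eq_mean]
    rfl
  have hopt : σ ∈ optimal p k ↔ ∀ x ∈ p.marginal.weights.support, ∀ α, V x α ≤ V x (σ x) := by
    refine forall_congr' fun x => ?_
    rw [Finsupp.mem_support_iff]
    refine forall_congr' fun hx => forall_congr' fun α => ?_
    rw [hV]
    simp only [dif_pos (show x ∈ p.marginal.supp from hx)]
  rw [hopt]
  constructor
  · intro h t
    simp only [hmean]
    exact Finset.sum_le_sum fun x hx =>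
      mul_le_mul_of_nonneg_left (h x hx _) (p.marginal.nonneg x)
  · intro h x hx α
    -- Deviating at the single type `x` leaves all other summands unchanged; they cancel, and the
    -- positive weight of `x` is divided out.
    have ht := h (Function.update σ x α)
    simp only [hmean] at ht
    rw [← Finset.add_sum_erase _ _ hx, ← Finset.add_sum_erase _ _ hx, Function.update_self,
      Finset.sum_congr rfl fun x' hx' => by
        rw [Function.update_of_ne (Finset.ne_of_mem_erase hx')]] at ht
    exact le_of_mul_le_mul_left (le_of_add_le_add_right ht)
      ((p.marginal.nonneg x).lt_of_ne' (Finsupp.mem_support_iff.1 hx))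

end Mean

/-! ### Ex ante utility in a Bayesian game -/

section BayesianGame

variable {n : ℕ} {A Θ : Fin n → Type u} [∀ i, Fintype (A i)] (B : BayesianGame n A Θ)

theorem BayesianGame.exAnte_eq_mean (i : Fin n) (s : ∀ j, Θ j → D (A j)) :
    B.exAnte i s =
      B.prior.mean fun θ => (D.pi fun j => s j (θ j)).mean fun a => B.utility i a θ := by
  simp only [mean_fintype (X := ∀ j, A j)]
  rfl

/-- Drawing the action of player `i` first, by `pi_update`, leaves exactly the sampling of the
others that `localOutcome` performs. This matches the ex ante form in `mem_optimal_iff`. -/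
theorem BayesianGame.exAnte_update (i : Fin n) (s : ∀ j, Θ j → D (A j)) (t : Θ i → D (A i)) :
    B.exAnte i (Function.update s i t) =
      (localState (B.prior.bind fun θ => dirac (PUnit.unit.{u + 1}, θ)) i).mean fun z =>
        (t z.2).mean fun y => expect (localOutcome (fun z => dirac fun i =>
          ⟨B.utility i (fun j => (z.2 j).2) fun j => (z.2 j).1⟩) s i (z.1, y)) := by
  have h : ∀ θ : ∀ j, Θ j, (fun j => Function.update s i t j (θ j)) =
      Function.update (fun j => s j (θ j)) i (t (θ i)) := fun θ =>
    funext fun j => Function.apply_update (fun j (f : Θ j → D (A j)) => f (θ j)) s i t j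
  rw [exAnte_eq_mean, localState]
  simp only [h, mean_bind, mean_dirac, localOutcome, expect_eq_mean]
  congr 1; funext θ
  rw [pi_update, mean_bind]

end BayesianGame

end BayesGames

/-! ### Assembly of the three parts -/

open BayesGames in
theorem mainTheorem5 :
    (∀ X Y : Type u, ∃ e : (copyAgent X Y).Strategy ≃ (X → D Y),
      (∀ s, (copyAgent X Y).play s =
        Lens.mk (A := PUnit) (fun x => (e s x).bind fun y => D.dirac (⟨⟩, (x, y)))
          fun _ => D.dirac ⟨⟩) ∧
      ∀ (Θ : Type u) (p : D (Θ × X)) (k : Θ × (X × Y) → D Outcome.{u}) s,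
        e '' (copyAgent X Y).br (Context.mk p k) s =
          (agent X Y).br
            (Context.mk (p.bind fun z => D.dirac (z, z.2)) fun w => k (w.1.1, (w.1.2, w.2)))
            (e s)) ∧
    (∀ (n : ℕ) (X Y : Fin n → Type u),
      ∃ e : (OpenGame.bigTensor fun i => copyAgent (X i) (Y i)).Strategy ≃
          (∀ i, X i → D (Y i)),
        (∀ s, (OpenGame.bigTensor fun i => copyAgent (X i) (Y i)).play s = explicitPlay (e s)) ∧
        (∀ (Θ : Type u) (p : D (Θ × (∀ i, X i)))
          (k : Θ × (∀ i, X i × Y i) → D (Fin n → Outcome.{u})) s,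
          e '' (OpenGame.bigTensor fun i => copyAgent (X i) (Y i)).br (Context.mk p k) s =
            Set.univ.pi fun i => {τ : X i → D (Y i) |
              ∀ x (hx : x ∈ (localState p i).marginal.supp),
                τ x ∈ argmax fun α : D (Y i) =>
                  expectedOutcome (localOutcome k (e s) i) ((localState p i).update x hx) α}) ∧
        ∀ [∀ i, Fintype (Y i)] (B : BayesianGame n Y X) s,
          s ∈ (OpenGame.bigTensor fun i => copyAgent (X i) (Y i)).br B.context s ↔
            B.IsBayesianNash (e s)) := by
  refine ⟨fun X Y => ⟨copyAgentEquiv X Y, copyAgent_play, fun Θ p k s => ?_⟩,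
    fun n X Y => ⟨bigTensorEquiv X Y, play_bigTensor X Y, fun Θ p k s => ?_, fun B s => ?_⟩⟩
  · refine Set.ext fun τ => ?_
    obtain ⟨t, rfl⟩ := (copyAgentEquiv X Y).surjective τ
    rw [(copyAgentEquiv X Y).injective.mem_set_image]
    exact mem_copyAgent_br p k s t
  · refine Set.ext fun τ => ?_
    obtain ⟨t, rfl⟩ := (bigTensorEquiv X Y).surjective τ
    rw [(bigTensorEquiv X Y).injective.mem_set_image, Set.mem_univ_pi]
    exact mem_bigTensor_br X Y p k s t
  · refine (mem_bigTensor_br X Y _ _ s s).trans (forall_congr' fun i => ?_)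
    -- On a class with a chosen representative, `preference` is `optimal` by definition.
    refine (mem_optimal_iff _ _ _).trans (forall_congr' fun t => ?_)
    -- Both the deviation and `σ i` itself appear as updates of the profile, so one formula rewrites
    -- both sides.
    exact iff_of_eq (congrArg₂ (· ≤ ·) (B.exAnte_update i _ _).symm (B.exAnte_update i _ _).symm)
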